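/- Let $\mathcal H$ be a real Hilbert space and let $f:\mathcal H\to\mathbb R\cup\{+\infty\}$ be proper, convex and lower semicontinuous with $\operatorname{argmin} f\neq\emptyset$. Let $\alpha,c,\lambda>0$, $0<q<1$, $1<p<q+1$ and $\delta\in\mathbb R$, and assume that either $p-q-1<\delta<0$, or $\delta=0$ and $\lambda<1$. Let $x_0,x_1\in\mathcal H$ be arbitrary and let $(x_k)$ be the sequence defined by $$x_{k+1}=\operatorname{prox}_{\lambda_k f}\left(x_k+\Big(1-\frac{\alpha}{k^q}\Big)(x_k-x_{k-1})-\frac{c}{k^p}x_k\right),\qquad \lambda_k=\lambda k^{\delta},\qquad k\ge 1,$$ where, for $s>0$, $\operatorname{prox}_{sf}(x)=\operatorname{argmin}_{y\in\mathcal H}\left(f(y)+\frac1{2s}\|y-x\|^2\right)$. Then $f$ has a unique minimizer $x^*$ of minimal norm, and $\liminf_{k\to+\infty}\|x_k-x^*\|=0$. Moreover, if $\|x_k\|<\|x^*\|$ for all sufficiently large $k$, or $\|x_k\|\ge\|x^*\|$ for all sufficiently large $k$ (that is, if $(x_k)$ eventually stays inside, or eventually stays outside, the open ball $B(0,\|x^*\|)$),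 then $x_k\to x^*$ strongly. -/

import Mathlib

open Filter Topology

/-- An extended-real-valued function `f : H → ℝ ∪ {+∞}` (the value `⊥` is excluded) that is
proper, i.e. finite at some point. -/
def IsProperFun {H : Type*} (f : H → EReal) : Prop :=
  (∀ x, f x ≠ ⊥) ∧ ∃ x, f x ≠ ⊤

/-- Convexity of an extended-real-valued function: Jensen's inequality with positive weights
(for a function that omits `⊥`, the right-hand side involves no indeterminate form). -/
def IsConvexFun {H : Type*} [AddCommGroup H] [Module ℝ H] (f : H → EReal) : Prop :=
  ∀ x y : H, ∀ a b : ℝ, 0 < a → 0 < b → a + b = 1 →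
    f (a • x + b • y) ≤ (a : EReal) * f x + (b : EReal) * f y

/-- The solution set `argmin f`. -/
def argminSet {H : Type*} (f : H → EReal) : Set H :=
  {x | ∀ y, f x ≤ f y}

/-- `xs` is a minimizer of `f` whose norm is least among all minimizers of `f`. -/
def IsMinNormMinimizer {H : Type*} [NormedAddCommGroup H] (f : H → EReal) (xs : H) : Prop :=
  xs ∈ argminSet f ∧ ∀ y ∈ argminSet f, ‖xs‖ ≤ ‖y‖

/-- `z = prox_{s f}(x)`: the point `z` minimizes `y ↦ f y + ‖y - x‖² / (2 s)` over `H`.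
For proper, convex, lower semicontinuous `f` and `s > 0` exactly one such `z` exists. -/
def IsProx {H : Type*} [NormedAddCommGroup H] (f : H → EReal) (s : ℝ) (x z : H) : Prop :=
  z ∈ argminSet (fun y => f y + ((1 / (2 * s) * ‖y - x‖ ^ 2 : ℝ) : EReal))

/-- The sequence `(x k)` is generated by the proximal inertial algorithm with Tikhonov
regularization, from arbitrary starting points `x 0`, `x 1`: for every `k ≥ 1`,
`x (k+1) = prox_{lam_k f} (y_k - c_k x_k)`, where `y_k = x_k + α_k (x_k - x_{k-1})`,
`α_k = 1 - α / k ^ q`, `c_k = c / k ^ p` and `lam_k = lam * k ^ δ`. -/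
def IsPIATRSequence {H : Type*} [NormedAddCommGroup H] [NormedSpace ℝ H] (f : H → EReal)
    (α q c p lam δ : ℝ) (x : ℕ → H) : Prop :=
  ∀ k : ℕ, 1 ≤ k →
    IsProx f (lam * (k : ℝ) ^ δ)
      ((x k + (1 - α / (k : ℝ) ^ q) • (x k - x (k - 1))) - (c / (k : ℝ) ^ p) • x k)
      (x (k + 1))

/-!
The algorithm discretizes `x'' + α t^(-q) x' + lam t^δ ∂f(x) + c t^(-p) x ∋ 0`, and the proof rests
on an energy that couples velocity and position. With `v_k = x_k - x_{k-1}`, `e_k = x_k - x*`,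
`a_k = α / k^q`, `c_k = c / k^p`, `lam_k = lam k^δ` and a constant `N`, put

`E_k = ‖v_k‖² / 2 + lam_k (f(x_k) - min f) + c_k / 2 (‖x_k‖² - N)
        + a_k / 4 (⟨v_k, e_k⟩ + a_{k-1} / 2 ‖e_{k-1}‖²)`.

Testing the variational inequality of the proximal step at `x_k` and at `x*` gives, for all large
`k` with `N ≤ ‖x_{k+1}‖²`,

`(1 + 4 / k) E_{k+1} ≤ E_k + a_k c_k / 8 (‖x*‖² - N)`   (`stepEnergy_le`).

The factor `1 + 4 / k` is available because `p < q + 1`: the dissipation `a_k c_k ‖e_k‖²` coming from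
the Tikhonov term dominates `a_k² ‖e_k‖² / k`. Two choices of `N` are used.

* `N = 0`. The perturbation has order `k^(-p-q)`, and `-δ < q + 1 - p < p + q - 1`, hence
  `k^(-δ) E_k → 0` and `f(x_k) → min f` (`tendsto_gap`). In the closed ball of radius `‖x*‖`, points
  where `f` is nearly minimal are near `x*` (`exists_sublevel_norm_sub_lt`), so the iterates that
  lie in the ball approach `x*`.
* `N = ‖x*‖²`, when the iterates eventually stay outside the ball. There is no perturbation, so
  `k² E_k → 0`; as `E_k` dominates `k^(-2q) ‖e_{k-1}‖²` up to a constant and `q < 1`, the whole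
  sequence converges (`tendsto_of_eventually_norm_le`).

A sequence that is not eventually outside the ball is inside it infinitely often, which gives the
lower limit in every case.
-/

/-! ### Sublevel sets and the minimizer of minimal norm -/

theorem exists_min_value {H : Type*} {f : H → EReal} (hproper : IsProperFun f)
    (hne : (argminSet f).Nonempty) :
    ∃ m : ℝ, argminSet f = {y | f y ≤ (m : EReal)} ∧ ∀ y, (m : EReal) ≤ f y := by
  obtain ⟨x₀, h₀⟩ := hne
  obtain ⟨hbot, y, hy⟩ := hproper
  have htop : f x₀ ≠ ⊤ := fun h => hy (top_le_iff.1 (h ▸ h₀ y))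
  refine ⟨(f x₀).toReal, ?_, ?_⟩
  · rw [EReal.coe_toReal htop (hbot x₀)]
    ext z
    exact ⟨fun hz => hz x₀, fun hz w => le_trans hz (h₀ w)⟩
  · rw [EReal.coe_toReal htop (hbot x₀)]
    exact h₀

section Convex

variable {H : Type*} [NormedAddCommGroup H] [InnerProductSpace ℝ H]

theorem IsConvexFun.convex_sublevel {f : H → EReal} (hconv : IsConvexFun f) (r : ℝ) :
    Convex ℝ {y | f y ≤ (r : EReal)} := by
  rw [convex_iff_forall_pos]
  intro x hx y hy a b ha hb hab
  have ha' : (0 : EReal) ≤ (a : EReal) := by exact_mod_cast ha.le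
  have hb' : (0 : EReal) ≤ (b : EReal) := by exact_mod_cast hb.le
  calc f (a • x + b • y) ≤ (a : EReal) * f x + (b : EReal) * f y := hconv x y a b ha hb hab
    _ ≤ (a : EReal) * (r : EReal) + (b : EReal) * (r : EReal) :=
        add_le_add (mul_le_mul_of_nonneg_left hx ha') (mul_le_mul_of_nonneg_left hy hb')
    _ = (r : EReal) := by
        rw [← EReal.coe_mul, ← EReal.coe_mul, ← EReal.coe_add, ← add_mul, hab, one_mul]

/-- The parallelogram identity, in the form used for points whose midpoint has norm at least
`d`. -/
theorem sq_norm_sub_le_of_le_norm_midpoint {x y : H} {d : ℝ} (hd : 0 ≤ d)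
    (h : d ≤ ‖midpoint ℝ x y‖) : ‖x - y‖ ^ 2 ≤ 2 * ‖x‖ ^ 2 + 2 * ‖y‖ ^ 2 - 4 * d ^ 2 := by
  have h1 := parallelogram_law_with_norm ℝ x y
  have h2 : ‖x + y‖ = 2 * ‖midpoint ℝ x y‖ := by
    rw [midpoint_eq_smul_add, norm_smul]
    norm_num
    ring
  nlinarith [norm_nonneg (midpoint ℝ x y)]

theorem eq_of_isMinNormMinimizer {f : H → EReal} (hC : Convex ℝ (argminSet f)) {x y : H}
    (hx : IsMinNormMinimizer f x) (hy : IsMinNormMinimizer f y) : x = y := by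
  have h := sq_norm_sub_le_of_le_norm_midpoint (norm_nonneg x)
    (hx.2 _ (hC.midpoint_mem hx.1 hy.1))
  have hxy : ‖x‖ = ‖y‖ := le_antisymm (hx.2 y hy.1) (hy.2 x hx.1)
  rw [← hxy] at h
  have : ‖x - y‖ = 0 := by nlinarith [norm_nonneg (x - y)]
  exact sub_eq_zero.1 (norm_eq_zero.1 this)

theorem exists_min_norm_of_isClosed_convex [CompleteSpace H] {K : Set H} (hne : K.Nonempty)
    (hcl : IsClosed K) (hC : Convex ℝ K) : ∃ v ∈ K, ∀ y ∈ K, ‖v‖ ≤ ‖y‖ := by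
  obtain ⟨v, hv, h⟩ := exists_norm_eq_iInf_of_complete_convex hne hcl.isComplete hC 0
  refine ⟨v, hv, fun y hy => ?_⟩
  have h2 : ⨅ w : K, ‖0 - (w : H)‖ ≤ ‖0 - y‖ :=
    ciInf_le ⟨0, by rintro _ ⟨w, rfl⟩; exact norm_nonneg _⟩ (⟨y, hy⟩ : K)
  rw [← h] at h2
  simpa using h2

/-- Points of the closed ball `‖y‖ ≤ ‖xs‖` at which `f` is nearly minimal are near the
minimal norm minimizer `xs`: the least norms on the sublevel sets of `f` increase to `‖xs‖`, and
the midpoint of `y` and `xs` lies in the same sublevel set as `y`. -/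
theorem exists_sublevel_norm_sub_lt [CompleteSpace H] {f : H → EReal} (hconv : IsConvexFun f)
    (hlsc : LowerSemicontinuous f) {m : ℝ} (hm : argminSet f = {y | f y ≤ (m : EReal)})
    {xs : H} (hxs : IsMinNormMinimizer f xs) {η : ℝ} (hη : 0 < η) :
    ∃ ε : ℝ, 0 < ε ∧ ∀ y, f y ≤ ((m + ε : ℝ) : EReal) → ‖y‖ ≤ ‖xs‖ → ‖y - xs‖ < η := by
  set C : ℕ → Set H := fun n => {y | f y ≤ ((m + 1 / ((n : ℝ) + 1) : ℝ) : EReal)} with hCdef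
  have hanti : ∀ {i j : ℕ}, i ≤ j → C j ⊆ C i := by
    intro i j hij y hy
    refine le_trans hy (EReal.coe_le_coe_iff.2 ?_)
    have := Nat.one_div_le_one_div (α := ℝ) hij
    linarith
  have hconvC : ∀ n, Convex ℝ (C n) := fun n => hconv.convex_sublevel _
  have hclosed : ∀ n, IsClosed (C n) := fun n => hlsc.isClosed_preimage _
  have hxsC : ∀ n, xs ∈ C n := by
    intro n
    have h1 : f xs ≤ (m : EReal) := by
      have := hxs.1
      rwa [hm] at this
    refine le_trans h1 (EReal.coe_le_coe_iff.2 ?_)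
    have := Nat.one_div_pos_of_nat (α := ℝ) (n := n)
    linarith
  choose p hpC hpmin using fun n =>
    exists_min_norm_of_isClosed_convex ⟨xs, hxsC n⟩ (hclosed n) (hconvC n)
  have hmono : Monotone fun n => ‖p n‖ ^ 2 := by
    intro i j hij
    have := hpmin i _ (hanti hij (hpC j))
    dsimp only
    gcongr
  have hbdd : BddAbove (Set.range fun n => ‖p n‖ ^ 2) := by
    refine ⟨‖xs‖ ^ 2, ?_⟩
    rintro _ ⟨n, rfl⟩
    have := hpmin n _ (hxsC n)
    dsimp only
    gcongr
  have hlim := tendsto_atTop_ciSup hmono hbdd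
  set L := ⨆ n, ‖p n‖ ^ 2 with hL
  -- the least-norm points form a Cauchy sequence since their norms converge
  have hcauchy : CauchySeq p := by
    rw [Metric.cauchySeq_iff']
    intro ε hε
    obtain ⟨n, hn⟩ := (hlim.eventually (lt_mem_nhds
      (show L - ε ^ 2 / 2 < L by have := pow_pos hε 2; linarith))).exists
    refine ⟨n, fun k hk => ?_⟩
    have h1 := sq_norm_sub_le_of_le_norm_midpoint (norm_nonneg (p n))
      (hpmin n _ ((hconvC n).midpoint_mem (hanti hk (hpC k)) (hpC n)))
    have h2 : ‖p k‖ ^ 2 ≤ L := le_ciSup hbdd k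
    rw [dist_eq_norm]
    refine lt_of_pow_lt_pow_left₀ 2 hε.le ?_
    linarith
  obtain ⟨P, hP⟩ := cauchySeq_tendsto_of_complete hcauchy
  have hPC : ∀ n, P ∈ C n := fun n => (hclosed n).mem_of_tendsto hP
    (eventually_atTop.2 ⟨n, fun k hk => hanti hk (hpC k)⟩)
  have hPmin : P ∈ argminSet f := by
    rw [hm]
    have h1 : Tendsto (fun n : ℕ => ((m + 1 / ((n : ℝ) + 1) : ℝ) : EReal)) atTop
        (𝓝 ((m + 0 : ℝ) : EReal)) :=
      (continuous_coe_real_ereal.tendsto _).comp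
        (tendsto_const_nhds.add tendsto_one_div_add_atTop_nhds_zero_nat)
    rw [add_zero] at h1
    exact ge_of_tendsto' h1 hPC
  have hLP : L = ‖P‖ ^ 2 := tendsto_nhds_unique hlim (hP.norm.pow 2)
  have hPxs : ‖xs‖ ^ 2 ≤ L := by
    rw [hLP]
    have := hxs.2 P hPmin
    gcongr
  obtain ⟨n, hn⟩ := (hlim.eventually (lt_mem_nhds
      (show L - η ^ 2 / 4 < L by have := pow_pos hη 2; linarith))).exists
  refine ⟨1 / ((n : ℝ) + 1), Nat.one_div_pos_of_nat, fun y hy hyn => ?_⟩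
  have h1 := sq_norm_sub_le_of_le_norm_midpoint (norm_nonneg (p n))
    (hpmin n _ ((hconvC n).midpoint_mem hy (hxsC n)))
  have h2 : ‖y‖ ^ 2 ≤ ‖xs‖ ^ 2 := by gcongr
  refine lt_of_pow_lt_pow_left₀ 2 hη.le ?_
  linarith

/-! ### The variational inequality of the proximal point -/

theorem IsProx.ne_top {H : Type*} [NormedAddCommGroup H] {f : H → EReal} {s : ℝ}
    {x z y : H} (h : IsProx f s x z)
    (hy : f y ≠ ⊤) : f z ≠ ⊤ := by
  intro hz
  have h1 := h y
  simp only [hz, EReal.top_add_coe, top_le_iff] at h1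
  exact (EReal.add_lt_top hy (EReal.coe_ne_top _)).ne h1

/-- The optimality condition `(x - z) / s ∈ ∂f(z)` for `z = prox_{s f}(x)`, tested at a point `y`
where `f` is finite. -/
theorem IsProx.variational_ineq {f : H → EReal} (hbot : ∀ w, f w ≠ ⊥) (hconv : IsConvexFun f)
    {s : ℝ} (hs : 0 < s) {x z y : H} (h : IsProx f s x z) (hy : f y ≠ ⊤) :
    s * ((f z).toReal - (f y).toReal) ≤ inner ℝ (x - z) (z - y) := by
  have hz := h.ne_top hy
  obtain ⟨u, hu⟩ : ∃ u : ℝ, f z = u := ⟨_, (EReal.coe_toReal hz (hbot z)).symm⟩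
  obtain ⟨w, hw⟩ : ∃ w : ℝ, f y = w := ⟨_, (EReal.coe_toReal hy (hbot y)).symm⟩
  rw [hu, hw, EReal.toReal_coe, EReal.toReal_coe]
  -- comparison of `z` with the points of the segment from `z` to `y`
  have key : ∀ t : ℝ, 0 < t → t < 1 →
      s * (u - w) ≤ inner ℝ (x - z) (z - y) + t * (‖y - z‖ ^ 2 / 2) := by
    intro t ht0 ht1
    have h1 := h ((1 - t) • z + t • y)
    have h2 := hconv z y (1 - t) t (by linarith) ht0 (by ring)
    have h3 : (u : EReal) + ((1 / (2 * s) * ‖z - x‖ ^ 2 : ℝ) : EReal) ≤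
        (((1 - t) * u + t * w : ℝ) : EReal) +
          ((1 / (2 * s) * ‖(1 - t) • z + t • y - x‖ ^ 2 : ℝ) : EReal) := by
      rw [hu, hw, ← EReal.coe_mul, ← EReal.coe_mul, ← EReal.coe_add] at h2
      rw [← hu]
      exact le_trans h1 (add_le_add_left h2 _)
    rw [← EReal.coe_add, ← EReal.coe_add, EReal.coe_le_coe_iff] at h3
    have h4 : (1 - t) • z + t • y - x = t • (y - z) - (x - z) := by module
    have h5 : inner ℝ (x - z) (z - y) = - inner ℝ (y - z) (x - z) := by
      rw [← neg_sub y z, inner_neg_right, real_inner_comm]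
    rw [h4, norm_sub_sq_real (t • (y - z)), norm_smul, mul_pow, Real.norm_eq_abs, sq_abs, real_inner_smul_left,
      norm_sub_rev z x] at h3
    rw [h5]
    have h6 : t * (u - w) ≤
        1 / (2 * s) * (t * (t * ‖y - z‖ ^ 2 - 2 * inner ℝ (y - z) (x - z))) := by linarith
    rw [div_mul_eq_mul_div, one_mul, le_div_iff₀ (by positivity)] at h6
    have h7 : (u - w) * (2 * s) ≤ t * ‖y - z‖ ^ 2 - 2 * inner ℝ (y - z) (x - z) :=
      le_of_mul_le_mul_left (by linarith) ht0
    linarith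
  have hlim : Tendsto (fun t : ℝ => inner ℝ (x - z) (z - y) + t * (‖y - z‖ ^ 2 / 2)) (𝓝[>] 0)
      (𝓝 (inner ℝ (x - z) (z - y) + 0 * (‖y - z‖ ^ 2 / 2))) := by
    refine Tendsto.mono_left (Continuous.tendsto ?_ 0) nhdsWithin_le_nhds
    fun_prop
  rw [zero_mul, add_zero] at hlim
  refine ge_of_tendsto hlim ?_
  filter_upwards [Ioo_mem_nhdsGT (zero_lt_one' ℝ)] with t ht
  exact key t ht.1 ht.2

end Convex

/-! ### The energy of the inertial iteration -/

section Energy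

variable {H : Type*} [NormedAddCommGroup H] [InnerProductSpace ℝ H]

/-- The energy after a step from `x₀` to `x₁`, relative to the reference point `xs`. Here `F` is
the gap of the objective at `x₁`, `l` and `c` are the weights of the objective and of the Tikhonov
term, `N` is a constant subtracted in the latter, and `a₀`, `a` are the friction coefficients of
this step and of the next one. -/
noncomputable def stepEnergy (xs x₀ x₁ : H) (a₀ a c l F N : ℝ) : ℝ :=
  ‖x₁ - x₀‖ ^ 2 / 2 + l * F + c / 2 * (‖x₁‖ ^ 2 - N) +
    a / 4 * (inner ℝ (x₁ - x₀) (x₁ - xs) + a₀ / 2 * ‖x₀ - xs‖ ^ 2)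

variable {xs x₀ x₁ x₂ : H} {a₀ a a₂ c c₂ l l₂ F₁ F₂ N : ℝ}

theorem mul_inner_le_sq {u v : H} {a : ℝ} (ha : 0 < a) :
    |a * inner ℝ u v| ≤ ‖u‖ ^ 2 / 2 + a ^ 2 / 2 * ‖v‖ ^ 2 := by
  have h1 : |a * inner ℝ u v| ≤ a * (‖u‖ * ‖v‖) := by
    rw [abs_mul, abs_of_pos ha]
    exact mul_le_mul_of_nonneg_left (abs_real_inner_le_norm u v) ha.le
  nlinarith [sq_nonneg (‖u‖ - a * ‖v‖)]

theorem inner_sub_sub_eq (xs x₀ x₁ : H) :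
    inner ℝ (x₁ - x₀) (x₁ - xs) = ‖x₁ - x₀‖ ^ 2 + inner ℝ (x₁ - x₀) (x₀ - xs) := by
  rw [← real_inner_self_eq_norm_sq, ← inner_add_right]
  congr 1
  abel

theorem sq_norm_le_stepEnergy (ha : 0 < a) (ha₀ : a ≤ a₀) :
    l * F₁ + c / 2 * (‖x₁‖ ^ 2 - N) + a ^ 2 / 16 * ‖x₀ - xs‖ ^ 2 ≤
      stepEnergy xs x₀ x₁ a₀ a c l F₁ N := by
  unfold stepEnergy
  rw [inner_sub_sub_eq]
  have h1 := (abs_le.1 (mul_inner_le_sq (u := x₁ - x₀) (v := x₀ - xs) (half_pos ha))).1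
  have h2 : a * a * ‖x₀ - xs‖ ^ 2 ≤ a * a₀ * ‖x₀ - xs‖ ^ 2 := by gcongr
  have h3 : 0 ≤ a * ‖x₁ - x₀‖ ^ 2 := by positivity
  linarith [sq_nonneg ‖x₁ - x₀‖]

/-- Variation of the mechanical energy: the momentum equation tested with the new velocity. -/
theorem kinetic_step (ha1 : a ≤ 1)
    (h : l * (F₂ - F₁) ≤
      inner ℝ ((1 - a) • (x₁ - x₀) - (x₂ - x₁) - c • x₁) (x₂ - x₁)) :
    ‖x₂ - x₁‖ ^ 2 / 2 + l * F₂ + c / 2 * ‖x₂‖ ^ 2 ≤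
      ‖x₁ - x₀‖ ^ 2 / 2 + l * F₁ + c / 2 * ‖x₁‖ ^ 2
        - a / 2 * (‖x₂ - x₁‖ ^ 2 + ‖x₁ - x₀‖ ^ 2) + c / 2 * ‖x₂ - x₁‖ ^ 2 := by
  have hx₂ : ‖x₂‖ ^ 2 = ‖x₁‖ ^ 2 + 2 * inner ℝ x₁ (x₂ - x₁) + ‖x₂ - x₁‖ ^ 2 := by
    rw [← norm_add_sq_real]
    congr 2
    abel
  have hvw : 2 * inner ℝ (x₁ - x₀) (x₂ - x₁) ≤ ‖x₁ - x₀‖ ^ 2 + ‖x₂ - x₁‖ ^ 2 := by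
    have := norm_sub_sq_real (x₁ - x₀) (x₂ - x₁)
    nlinarith [sq_nonneg ‖x₁ - x₀ - (x₂ - x₁)‖]
  rw [inner_sub_left, inner_sub_left, real_inner_smul_left, real_inner_smul_left,
    real_inner_self_eq_norm_sq] at h
  rw [hx₂]
  nlinarith [mul_le_mul_of_nonneg_left hvw (sub_nonneg.2 ha1)]

/-- Variation of the mixed term: the momentum equation tested with `x₂ - xs`. -/
theorem mixed_step (ha : 0 ≤ a) (ha1 : a ≤ 1)
    (h : l * F₂ ≤ inner ℝ ((1 - a) • (x₁ - x₀) - (x₂ - x₁) - c • x₁) (x₂ - xs)) :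
    inner ℝ (x₂ - x₁) (x₂ - xs) + a / 2 * ‖x₁ - xs‖ ^ 2 ≤
      inner ℝ (x₁ - x₀) (x₁ - xs) + a / 2 * ‖x₀ - xs‖ ^ 2
        + (‖x₁ - x₀‖ ^ 2 + (1 + c) * ‖x₂ - x₁‖ ^ 2) / 2 - l * F₂
        - c / 2 * (‖x₂‖ ^ 2 - ‖xs‖ ^ 2) - c / 2 * ‖x₁ - xs‖ ^ 2 := by
  have hvw : 2 * inner ℝ (x₁ - x₀) (x₂ - x₁) ≤ ‖x₁ - x₀‖ ^ 2 + ‖x₂ - x₁‖ ^ 2 := by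
    have := norm_sub_sq_real (x₁ - x₀) (x₂ - x₁)
    nlinarith [sq_nonneg ‖x₁ - x₀ - (x₂ - x₁)‖]
  have hve : ‖x₀ - xs‖ ^ 2 =
      ‖x₁ - xs‖ ^ 2 - 2 * inner ℝ (x₁ - x₀) (x₁ - xs) + ‖x₁ - x₀‖ ^ 2 := by
    rw [real_inner_comm, ← norm_sub_sq_real]
    congr 2
    abel
  have hsplit : inner ℝ (x₁ - x₀) (x₂ - xs) =
      inner ℝ (x₁ - x₀) (x₁ - xs) + inner ℝ (x₁ - x₀) (x₂ - x₁) := by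
    rw [← inner_add_right]
    congr 1
    abel
  -- the Tikhonov force acts at `x₁`, not at `x₂`; this costs only `‖x₂ - x₁‖ ^ 2`
  have hx : 2 * inner ℝ x₁ (x₂ - xs) =
      ‖x₂‖ ^ 2 - ‖xs‖ ^ 2 + ‖x₁ - xs‖ ^ 2 - ‖x₂ - x₁‖ ^ 2 := by
    rw [norm_sub_sq_real, norm_sub_sq_real, inner_sub_right, real_inner_comm x₁ x₂]
    ring
  rw [inner_sub_left, inner_sub_left, real_inner_smul_left, real_inner_smul_left, hsplit] at h
  have h1 := mul_le_mul_of_nonneg_left hvw (sub_nonneg.2 ha1)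
  have h2 : 0 ≤ a * ‖x₂ - x₁‖ ^ 2 := by positivity
  have h3 : 0 ≤ a * ‖x₁ - x₀‖ ^ 2 := by positivity
  rw [hve]
  linear_combination h + h1 / 2 + h2 / 2 + h3 - c / 2 * hx

/-- One step contracts the energy by the factor `1 + 4 t`, up to a multiple of `‖xs‖ ^ 2 - N`.
In the application `t = 1 / k`. -/
theorem stepEnergy_le {t : ℝ} (ht : 0 ≤ t) (ha₂ : 0 < a₂) (ha₂a : a₂ ≤ a) (haa₀ : a ≤ a₀)
    (ha1 : a ≤ 1) (hat : a - a₂ ≤ a * t) (hl₂ : l₂ ≤ l) (hc₂ : c₂ ≤ c) (hc0 : 0 < c)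
    (hc1 : c ≤ 1) (hca : 8 * c ≤ a) (hta : 40 * t ≤ a) (htc : 8 * t * a ≤ c)
    (hF₂ : 0 ≤ F₂) (hl : 0 ≤ l) (hN : N ≤ ‖x₂‖ ^ 2)
    (hkin : l * (F₂ - F₁) ≤
      inner ℝ ((1 - a) • (x₁ - x₀) - (x₂ - x₁) - c • x₁) (x₂ - x₁))
    (hmix : l * F₂ ≤ inner ℝ ((1 - a) • (x₁ - x₀) - (x₂ - x₁) - c • x₁) (x₂ - xs)) :
    (1 + 4 * t) * stepEnergy xs x₁ x₂ a a₂ c₂ l₂ F₂ N ≤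
      stepEnergy xs x₀ x₁ a₀ a c l F₁ N + a * c / 8 * (‖xs‖ ^ 2 - N) := by
  have ha : 0 < a := ha₂.trans_le ha₂a
  have hk := kinetic_step ha1 hkin
  have hm := mixed_step ha.le ha1 hmix
  set V := ‖x₁ - x₀‖ ^ 2 with hV
  set W := ‖x₂ - x₁‖ ^ 2 with hW
  set B := ‖x₁ - xs‖ ^ 2 with hB
  have hV0 : 0 ≤ V := by positivity
  have hW0 : 0 ≤ W := by positivity
  have hB0 : 0 ≤ B := by positivity
  set X := ‖x₂‖ ^ 2 - N with hX
  have hX0 : 0 ≤ X := sub_nonneg.2 hN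
  have hlF : 0 ≤ l * F₂ := mul_nonneg hl hF₂
  -- the bracket of the new energy, bounded from both sides
  set R := inner ℝ (x₂ - x₁) (x₂ - xs) + a / 2 * B with hR
  have habs := abs_le.1 (mul_inner_le_sq (u := x₂ - x₁) (v := x₁ - xs) ha)
  rw [← hW, ← hB] at habs
  have hRW : R = W + inner ℝ (x₂ - x₁) (x₁ - xs) + a / 2 * B := by
    rw [hR, inner_sub_sub_eq]
  have hRlow : -W / 2 ≤ a * R := by
    rw [hRW]
    nlinarith [mul_nonneg ha.le hW0]
  have hRup : a * R ≤ 3 / 2 * W + a ^ 2 * B := by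
    rw [hRW]
    nlinarith [mul_nonneg (sub_nonneg.2 ha1) hW0]
  have hE₁ : stepEnergy xs x₀ x₁ a₀ a c l F₁ N =
      V / 2 + l * F₁ + c / 2 * (‖x₁‖ ^ 2 - N) +
        a / 4 * (inner ℝ (x₁ - x₀) (x₁ - xs) + a₀ / 2 * ‖x₀ - xs‖ ^ 2) := rfl
  have hE₂ : stepEnergy xs x₁ x₂ a a₂ c₂ l₂ F₂ N =
      W / 2 + l₂ * F₂ + c₂ / 2 * X + a₂ / 4 * R := rfl
  have hE₂' : stepEnergy xs x₁ x₂ a a₂ c₂ l₂ F₂ N ≤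
      W / 2 + l * F₂ + c / 2 * X + a / 4 * R + t * W / 8 := by
    rw [hE₂]
    have h1 : l₂ * F₂ ≤ l * F₂ := by gcongr
    have h2 : c₂ / 2 * X ≤ c / 2 * X := by gcongr
    -- `(a - a₂) R ≥ -(a - a₂) / (2 a) W ≥ -t W / 2`
    have h3 : -(t * W / 2) ≤ (a - a₂) * R := by
      rcases le_total 0 R with hR0 | hR0
      · have := mul_nonneg (sub_nonneg.2 ha₂a) hR0
        have := mul_nonneg ht hW0
        linarith
      · have h4 : a * t * R ≤ (a - a₂) * R := mul_le_mul_of_nonpos_right hat hR0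
        have h5 := mul_le_mul_of_nonneg_left hRlow ht
        linarith
    linarith
  have hstep : W / 2 + l * F₂ + c / 2 * X + a / 4 * R ≤
      stepEnergy xs x₀ x₁ a₀ a c l F₁ N + a * c / 8 * (‖xs‖ ^ 2 - N)
        - a / 2 * (W + V) + c / 2 * W + a / 8 * (V + (1 + c) * W)
        - a / 4 * (l * F₂) - a * c / 8 * X - a * c / 8 * B := by
    rw [hE₁]
    have h1 := mul_le_mul_of_nonneg_left hm (show 0 ≤ a / 4 by positivity)
    have h2 : a / 4 * (a / 2 * ‖x₀ - xs‖ ^ 2) ≤ a / 4 * (a₀ / 2 * ‖x₀ - xs‖ ^ 2) := by gcongr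
    rw [hX]
    linarith
  have hbound : stepEnergy xs x₁ x₂ a a₂ c₂ l₂ F₂ N ≤
      W + l * F₂ + c / 2 * X + a ^ 2 / 4 * B := by
    have : t * W ≤ 1 / 40 * W := by
      gcongr
      linarith
    linarith
  have h1 := mul_le_mul_of_nonneg_left hbound (show 0 ≤ 4 * t by positivity)
  have h2 : 40 * t * W ≤ a * W := by gcongr
  have h3 : 40 * t * (l * F₂) ≤ a * (l * F₂) := by gcongr
  have h4 : 40 * t * (c * X) ≤ a * (c * X) := by gcongr
  have h5 : 8 * t * a * (a * B) ≤ c * (a * B) := by gcongr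
  have h6 : 8 * c * W ≤ a * W := by gcongr
  have h7 : c * (a * W) ≤ 1 * (a * W) := by gcongr
  have h8 : 0 ≤ a * V := by positivity
  have h9 : 0 ≤ t * (c * X) := by positivity
  have h10 : 0 ≤ t * (l * F₂) := by positivity
  have h11 : 0 ≤ t * W := by positivity
  linarith

end Energy

/-! ### Real sequences -/

/-- A nonnegative sequence with `(1 + t k) T (k + 1) ≤ T k + t k * η k`, where `t k ≥ 0` is not
summable and `η k → 0`, tends to `0`. -/
theorem tendsto_zero_of_contraction {T t η : ℕ → ℝ} (hT : ∀ᶠ k in atTop, 0 ≤ T k)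
    (ht : ∀ k, 0 ≤ t k) (hsum : ¬ Summable t) (hη : Tendsto η atTop (𝓝 0))
    (h : ∀ᶠ k in atTop, (1 + t k) * T (k + 1) ≤ T k + t k * η k) :
    Tendsto T atTop (𝓝 0) := by
  rw [Metric.tendsto_atTop]
  intro ε hε
  obtain ⟨n, hn⟩ := eventually_atTop.1 (hT.and (h.and
    (hη.eventually (gt_mem_nhds (half_pos hε)))))
  -- the excess of `T` over `ε / 2`
  set S : ℕ → ℝ := fun k => max (T (n + k) - ε / 2) 0 with hS
  have hS0 : ∀ k, 0 ≤ S k := fun k => le_max_right _ _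
  have hstep : ∀ k, (1 + t (n + k)) * S (k + 1) ≤ S k := by
    intro k
    obtain ⟨-, h1, h2⟩ := hn (n + k) (Nat.le_add_right _ _)
    have h3 : T (n + k) - ε / 2 ≤ S k := le_max_left _ _
    have h4 := ht (n + k)
    have h5 := mul_le_mul_of_nonneg_left h2.le h4
    rw [hS, mul_max_of_nonneg _ _ (by linarith), mul_zero]
    refine max_le ?_ (hS0 k)
    rw [← add_assoc]
    linarith
  have hsumS : ∀ K, S K + ∑ k ∈ Finset.range K, t (n + k) * S (k + 1) ≤ S 0 := by
    intro K
    induction K with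
    | zero => simp
    | succ K ih =>
      rw [Finset.sum_range_succ]
      have := hstep K
      linarith
  have hanti : Antitone S := antitone_nat_of_succ_le fun k => by
    have := hstep k
    nlinarith [mul_nonneg (ht (n + k)) (hS0 (k + 1))]
  have hex : ∃ K, S K < ε / 2 := by
    by_contra! hcon
    refine hsum ((summable_nat_add_iff n).1 ?_)
    refine summable_of_sum_range_le (c := S 0 / (ε / 2)) (fun k => ht _) fun K => ?_
    rw [le_div_iff₀ (half_pos hε), Finset.sum_mul]
    refine le_trans (Finset.sum_le_sum fun k _ => ?_)
      ((le_add_of_nonneg_left (hS0 K)).trans (hsumS K))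
    rw [add_comm k n]
    exact mul_le_mul_of_nonneg_left (hcon (k + 1)) (ht _)
  obtain ⟨K, hK⟩ := hex
  refine ⟨n + K, fun k hk => ?_⟩
  obtain ⟨j, rfl⟩ := Nat.exists_eq_add_of_le (le_of_add_le_left hk)
  have h1 : S j < ε / 2 := (hanti (by omega)).trans_lt hK
  have h2 : T (n + j) - ε / 2 ≤ S j := le_max_left _ _
  rw [Real.dist_0_eq_abs, abs_of_nonneg (hn _ (Nat.le_add_right _ _)).1]
  linarith

/-- Polynomial decay of a nonnegative sequence that contracts by `1 + 4 / k` in each step, up to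
a perturbation `r k = o(k ^ (-σ - 1))`. -/
theorem tendsto_rpow_mul_of_contraction {E r : ℕ → ℝ} {σ : ℝ} (hσ2 : σ ≤ 2)
    (hE : ∀ᶠ k in atTop, 0 ≤ E k)
    (hr : Tendsto (fun k : ℕ => (k : ℝ) ^ (σ + 1) * r k) atTop (𝓝 0))
    (hr0 : ∀ᶠ k in atTop, 0 ≤ r k)
    (h : ∀ᶠ k : ℕ in atTop, (1 + 4 * (1 / (k : ℝ))) * E (k + 1) ≤ E k + r k) :
    Tendsto (fun k : ℕ => (k : ℝ) ^ σ * E k) atTop (𝓝 0) := by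
  refine tendsto_zero_of_contraction (t := fun k : ℕ => 1 / (k : ℝ))
    (η := fun k : ℕ => (k : ℝ) ^ (σ + 1) * r k) ?_ (fun k => by positivity)
    Real.not_summable_one_div_natCast hr ?_
  · filter_upwards [hE] with k hk
    positivity
  filter_upwards [h, (tendsto_add_atTop_nat 1).eventually hE, hr0, eventually_ge_atTop 4]
    with k hk hE1 hrk hk4
  have hk0 : (0 : ℝ) < k := by
    have : 0 < k := by omega
    exact_mod_cast this
  set t : ℝ := 1 / (k : ℝ) with ht
  have ht0 : 0 < t := by positivity
  have ht4 : t ≤ 1 / 4 := by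
    rw [ht]
    have : (4 : ℝ) ≤ k := by exact_mod_cast hk4
    gcongr
  have hk1 : ((k + 1 : ℕ) : ℝ) = k * (1 + t) := by
    rw [ht]
    push_cast
    field_simp
  have hpow : (1 + t) ^ σ ≤ (1 + t) ^ 2 := by
    rw [← Real.rpow_two]
    exact Real.rpow_le_rpow_of_exponent_le (by linarith) hσ2
  have hr' : t * ((k : ℝ) ^ (σ + 1) * r k) = (k : ℝ) ^ σ * r k := by
    rw [Real.rpow_add_one hk0.ne', ht]
    field_simp
  rw [hr', hk1, Real.mul_rpow hk0.le (by linarith), ← mul_add]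
  calc (1 + t) * ((k : ℝ) ^ σ * (1 + t) ^ σ * E (k + 1))
      = (k : ℝ) ^ σ * ((1 + t) * (1 + t) ^ σ * E (k + 1)) := by ring
    _ ≤ (k : ℝ) ^ σ * ((1 + 4 * t) * E (k + 1)) := by
        gcongr
        calc (1 + t) * (1 + t) ^ σ ≤ (1 + t) * (1 + t) ^ 2 := by gcongr
          _ ≤ 1 + 4 * t := by nlinarith [mul_nonneg ht0.le (sub_nonneg.2 ht4)]
    _ ≤ (k : ℝ) ^ σ * (E k + r k) := by gcongr

theorem eventually_div_rpow_le_div_rpow {u w A B : ℝ} (huw : u < w) (hB : 0 < B) :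
    ∀ᶠ k : ℕ in atTop, A / (k : ℝ) ^ w ≤ B / (k : ℝ) ^ u := by
  have h1 : Tendsto (fun k : ℕ => A * (k : ℝ) ^ (-(w - u))) atTop (𝓝 (A * 0)) :=
    ((tendsto_rpow_neg_atTop (sub_pos.2 huw)).comp tendsto_natCast_atTop_atTop).const_mul A
  rw [mul_zero] at h1
  filter_upwards [h1.eventually (gt_mem_nhds hB), eventually_gt_atTop 0] with k hk hk0
  have hk0' : (0 : ℝ) < k := by exact_mod_cast hk0
  have h2 : A / (k : ℝ) ^ w = A * (k : ℝ) ^ (-(w - u)) / (k : ℝ) ^ u := by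
    rw [neg_sub, Real.rpow_sub hk0']
    field_simp
  rw [h2]
  gcongr

theorem div_rpow_succ_le {A u : ℝ} (hA : 0 ≤ A) (hu : 0 ≤ u) {k : ℕ} (hk : 0 < k) :
    A / ((k + 1 : ℕ) : ℝ) ^ u ≤ A / (k : ℝ) ^ u := by
  have hk0' : (0 : ℝ) < k := by exact_mod_cast hk
  gcongr
  omega

theorem div_rpow_sub_succ_le {A u : ℝ} (hA : 0 ≤ A) (hu1 : u ≤ 1) {k : ℕ} (hk : 0 < k) :
    A / (k : ℝ) ^ u - A / ((k + 1 : ℕ) : ℝ) ^ u ≤ A / (k : ℝ) ^ u * (1 / (k : ℝ)) := by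
  have hk0 : (0 : ℝ) < k := by exact_mod_cast hk
  have hk1 : ((k + 1 : ℕ) : ℝ) = k * (1 + 1 / k) := by
    push_cast
    field_simp
  set t : ℝ := 1 / (k : ℝ) with ht
  have ht0 : 0 < t := by positivity
  have hpow : (1 + t) ^ u ≤ 1 + t := by
    simpa using Real.rpow_le_rpow_of_exponent_le (by linarith : 1 ≤ 1 + t) hu1
  have hpos : 0 < (1 + t) ^ u := by positivity
  rw [hk1, Real.mul_rpow hk0.le (by linarith), ← div_div]
  set D := A / (k : ℝ) ^ u with hD
  have hD0 : 0 ≤ D := by positivity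
  have h1 : D * (1 - t) ≤ D / (1 + t) ^ u := by
    rw [le_div_iff₀ hpos, mul_assoc]
    refine mul_le_of_le_one_right hD0 ?_
    rcases le_total t 1 with h | h
    · nlinarith
    · nlinarith
  linarith

/-! ### The energy along the iteration -/

section Iteration

variable {H : Type*} [NormedAddCommGroup H] [InnerProductSpace ℝ H]

/-- `stepEnergy` along the sequence `x`, with the coefficients of the algorithm; `m` is the minimum
of `f`. -/
noncomputable def iterEnergy (f : H → EReal) (α q c p lam δ m N : ℝ) (xs : H) (x : ℕ → H)
    (k : ℕ) : ℝ :=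
  stepEnergy xs (x (k - 1)) (x k) (α / ((k - 1 : ℕ) : ℝ) ^ q) (α / (k : ℝ) ^ q)
    (c / (k : ℝ) ^ p) (lam * (k : ℝ) ^ δ) ((f (x k)).toReal - m) N

variable {f : H → EReal} {α q c p lam δ m N : ℝ} {xs : H} {x : ℕ → H}

theorem IsPIATRSequence.ne_top (hx : IsPIATRSequence f α q c p lam δ x) (hxs : f xs ≠ ⊤)
    {k : ℕ} (hk : 2 ≤ k) : f (x k) ≠ ⊤ := by
  obtain ⟨j, rfl⟩ := Nat.exists_eq_add_of_le' (show 1 ≤ k by omega)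
  exact (hx j (by omega)).ne_top hxs

theorem le_iterEnergy (hα : 0 < α) (hq : 0 ≤ q) {k : ℕ} (hk : 2 ≤ k) :
    lam * (k : ℝ) ^ δ * ((f (x k)).toReal - m) + c / (k : ℝ) ^ p / 2 * (‖x k‖ ^ 2 - N) +
      (α / (k : ℝ) ^ q) ^ 2 / 16 * ‖x (k - 1) - xs‖ ^ 2 ≤
        iterEnergy f α q c p lam δ m N xs x k := by
  have hk0 : (0 : ℝ) < k := by
    have : 0 < k := by omega
    exact_mod_cast this
  refine sq_norm_le_stepEnergy (by positivity) ?_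
  obtain ⟨j, rfl⟩ := Nat.exists_eq_add_of_le' (show 1 ≤ k by omega)
  exact div_rpow_succ_le hα.le hq (by omega)

theorem eventually_iterEnergy_succ_le (hbot : ∀ y, f y ≠ ⊥) (hconv : IsConvexFun f)
    (hmin : ∀ y, (m : EReal) ≤ f y) (hxs : f xs = m) (hα : 0 < α) (hc : 0 < c) (hq0 : 0 < q)
    (hq1 : q < 1) (hp1 : 1 < p) (hpq : p < q + 1) (hlam : 0 < lam) (hδ : δ ≤ 0)
    (hx : IsPIATRSequence f α q c p lam δ x) (hN : ∀ᶠ k in atTop, N ≤ ‖x k‖ ^ 2) :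
    ∀ᶠ k : ℕ in atTop, (1 + 4 * (1 / (k : ℝ))) * iterEnergy f α q c p lam δ m N xs x (k + 1) ≤
      iterEnergy f α q c p lam δ m N xs x k +
        α / (k : ℝ) ^ q * (c / (k : ℝ) ^ p) / 8 * (‖xs‖ ^ 2 - N) := by
  have hxs_top : f xs ≠ ⊤ := by
    rw [hxs]
    exact EReal.coe_ne_top m
  filter_upwards [(tendsto_add_atTop_nat 1).eventually hN, eventually_ge_atTop 2,
    eventually_div_rpow_le_div_rpow (A := α) hq0 one_pos,
    eventually_div_rpow_le_div_rpow (A := c) (zero_lt_one.trans hp1) one_pos,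
    eventually_div_rpow_le_div_rpow (A := 8 * c) (hq1.trans hp1) hα,
    eventually_div_rpow_le_div_rpow (A := 40) hq1 hα,
    eventually_div_rpow_le_div_rpow (A := 8 * α) hpq hc] with k hNk hk2 h1 h2 h3 h4 h5
  have hk0 : (0 : ℝ) < k := by
    have : 0 < k := by omega
    exact_mod_cast this
  rw [Real.rpow_zero, div_one] at h1 h2
  rw [Real.rpow_one] at h4
  rw [Real.rpow_add_one hk0.ne'] at h5
  have hgap : ∀ y, f y ≠ ⊤ → 0 ≤ (f y).toReal - m := fun y hy =>
    sub_nonneg.2 (EReal.coe_le_coe_iff.1 ((hmin y).trans_eq (EReal.coe_toReal hy (hbot y)).symm))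
  have hvec : x k + (1 - α / (k : ℝ) ^ q) • (x k - x (k - 1)) - (c / (k : ℝ) ^ p) • x k
      - x (k + 1) =
      (1 - α / (k : ℝ) ^ q) • (x k - x (k - 1)) - (x (k + 1) - x k) - (c / (k : ℝ) ^ p) • x k := by
    abel
  have hs : 0 < lam * (k : ℝ) ^ δ := by positivity
  have hvi := fun y hy => (hx k (by omega)).variational_ineq (y := y) hbot hconv hs hy
  have hkin := hvi (x k) (hx.ne_top hxs_top hk2)
  have hmix := hvi xs hxs_top
  rw [hvec] at hkin hmix
  rw [hxs, EReal.toReal_coe] at hmix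
  unfold iterEnergy
  rw [Nat.add_sub_cancel]
  refine stepEnergy_le (t := 1 / (k : ℝ)) (by positivity) (by positivity)
    (div_rpow_succ_le hα.le hq0.le (by omega)) ?_ h1
    (div_rpow_sub_succ_le hα.le hq1.le (by omega)) ?_
    (div_rpow_succ_le hc.le (zero_lt_one.trans hp1).le (by omega)) (by positivity) h2 ?_ ?_ ?_
    (hgap _ (hx.ne_top hxs_top (by omega))) hs.le hNk ?_ hmix
  · obtain ⟨j, rfl⟩ := Nat.exists_eq_add_of_le' (show 1 ≤ k by omega)
    exact div_rpow_succ_le hα.le hq0.le (by omega)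
  · refine mul_le_mul_of_nonneg_left ?_ hlam.le
    exact Real.rpow_le_rpow_of_nonpos hk0 (by push_cast; linarith) hδ
  · rwa [mul_div_assoc] at h3
  · rwa [mul_one_div]
  · refine le_trans (le_of_eq ?_) h5
    field_simp
  · rwa [sub_sub_sub_cancel_right]

/-- The objective gap tends to `0` along the whole sequence. -/
theorem tendsto_gap (hbot : ∀ y, f y ≠ ⊥) (hconv : IsConvexFun f)
    (hmin : ∀ y, (m : EReal) ≤ f y) (hxs : f xs = m) (hα : 0 < α) (hc : 0 < c) (hq0 : 0 < q)
    (hq1 : q < 1) (hp1 : 1 < p) (hpq : p < q + 1) (hlam : 0 < lam) (hδ : δ ≤ 0)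
    (hpδ : p - q - 1 < δ) (hx : IsPIATRSequence f α q c p lam δ x) :
    Tendsto (fun k => (f (x k)).toReal - m) atTop (𝓝 0) := by
  have hxs_top : f xs ≠ ⊤ := by
    rw [hxs]
    exact EReal.coe_ne_top m
  have hgap : ∀ k, 2 ≤ k → 0 ≤ (f (x k)).toReal - m := fun k hk =>
    sub_nonneg.2 (EReal.coe_le_coe_iff.1 ((hmin _).trans_eq
      (EReal.coe_toReal (hx.ne_top hxs_top hk) (hbot _)).symm))
  have hlow : ∀ k : ℕ, 2 ≤ k → lam * (k : ℝ) ^ δ * ((f (x k)).toReal - m) ≤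
      iterEnergy f α q c p lam δ m 0 xs x k := fun k hk => by
    refine le_trans ?_ (le_iterEnergy hα hq0.le hk)
    rw [sub_zero, add_assoc]
    exact le_add_of_nonneg_right (by positivity)
  have hrate : Tendsto (fun k : ℕ => (k : ℝ) ^ (-δ) * iterEnergy f α q c p lam δ m 0 xs x k)
      atTop (𝓝 0) := by
    refine tendsto_rpow_mul_of_contraction (by linarith) ?_ ?_ ?_
      (eventually_iterEnergy_succ_le hbot hconv hmin hxs hα hc hq0 hq1 hp1 hpq hlam hδ hx
        (Eventually.of_forall fun k => by positivity))
    · filter_upwards [eventually_ge_atTop 2] with k hk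
      exact le_trans (mul_nonneg (by positivity) (hgap k hk)) (hlow k hk)
    · -- the perturbation is of order `k ^ (-p - q)`, and `1 - δ < q + p`
      have h1 : Tendsto (fun k : ℕ => α * c / 8 * ‖xs‖ ^ 2 * (k : ℝ) ^ (-(q + p - (-δ + 1)))) atTop
          (𝓝 (α * c / 8 * ‖xs‖ ^ 2 * 0)) :=
        ((tendsto_rpow_neg_atTop (by linarith)).comp tendsto_natCast_atTop_atTop).const_mul _
      rw [mul_zero] at h1
      refine h1.congr' ?_
      filter_upwards [eventually_gt_atTop 0] with k hk
      have hk0 : (0 : ℝ) < k := by exact_mod_cast hk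
      rw [neg_sub, Real.rpow_sub hk0 (-δ + 1) (q + p), Real.rpow_add hk0 q p]
      field_simp
      ring
    · filter_upwards with k
      rw [sub_zero]
      positivity
  have hdiv := hrate.div_const lam
  rw [zero_div] at hdiv
  refine squeeze_zero' ?_ ?_ hdiv
  · filter_upwards [eventually_ge_atTop 2] with k hk using hgap k hk
  · filter_upwards [eventually_ge_atTop 2] with k hk
    have hk0 : (0 : ℝ) < k := by
      have : 0 < k := by omega
      exact_mod_cast this
    rw [le_div_iff₀ hlam]
    have h1 := mul_le_mul_of_nonneg_left (hlow k hk) (show 0 ≤ (k : ℝ) ^ (-δ) by positivity)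
    have h2 : (k : ℝ) ^ (-δ) * (k : ℝ) ^ δ = 1 := by
      rw [← Real.rpow_add hk0, neg_add_cancel, Real.rpow_zero]
    calc ((f (x k)).toReal - m) * lam
        = ((k : ℝ) ^ (-δ) * (k : ℝ) ^ δ) * (lam * ((f (x k)).toReal - m)) := by
          rw [h2]
          ring
      _ = (k : ℝ) ^ (-δ) * (lam * (k : ℝ) ^ δ * ((f (x k)).toReal - m)) := by ring
      _ ≤ _ := h1

/-- Outside the ball of radius `‖xs‖` the energy with `N = ‖xs‖ ^ 2` is nonnegative and contracts
without perturbation, so it decays faster than the weight of `‖x k - xs‖ ^ 2` in it. -/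
theorem tendsto_of_eventually_norm_le (hbot : ∀ y, f y ≠ ⊥) (hconv : IsConvexFun f)
    (hmin : ∀ y, (m : EReal) ≤ f y) (hxs : f xs = m) (hα : 0 < α) (hc : 0 < c) (hq0 : 0 < q)
    (hq1 : q < 1) (hp1 : 1 < p) (hpq : p < q + 1) (hlam : 0 < lam) (hδ : δ ≤ 0)
    (hx : IsPIATRSequence f α q c p lam δ x) (hout : ∀ᶠ k in atTop, ‖xs‖ ≤ ‖x k‖) :
    Tendsto x atTop (𝓝 xs) := by
  have hxs_top : f xs ≠ ⊤ := by
    rw [hxs]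
    exact EReal.coe_ne_top m
  have hN : ∀ᶠ k in atTop, ‖xs‖ ^ 2 ≤ ‖x k‖ ^ 2 := hout.mono fun k hk => by gcongr
  have hlow : ∀ᶠ k : ℕ in atTop, (α / (k : ℝ) ^ q) ^ 2 / 16 * ‖x (k - 1) - xs‖ ^ 2 ≤
      iterEnergy f α q c p lam δ m (‖xs‖ ^ 2) xs x k := by
    filter_upwards [hN, eventually_ge_atTop 2] with k hk hk2
    refine le_trans (le_add_of_nonneg_left ?_) (le_iterEnergy hα hq0.le hk2)
    have h1 : 0 ≤ (f (x k)).toReal - m :=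
      sub_nonneg.2 (EReal.coe_le_coe_iff.1 ((hmin _).trans_eq
        (EReal.coe_toReal (hx.ne_top hxs_top hk2) (hbot _)).symm))
    have h2 := sub_nonneg.2 hk
    positivity
  have hrate : Tendsto (fun k : ℕ => (k : ℝ) ^ (2 : ℝ) *
      iterEnergy f α q c p lam δ m (‖xs‖ ^ 2) xs x k) atTop (𝓝 0) := by
    refine tendsto_rpow_mul_of_contraction (r := fun _ => 0) le_rfl ?_ ?_ ?_ ?_
    · filter_upwards [hlow] with k hk
      exact le_trans (by positivity) hk
    · simp
    · simp
    · simpa using eventually_iterEnergy_succ_le hbot hconv hmin hxs hα hc hq0 hq1 hp1 hpq hlam hδ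
        hx hN
  have hsq : Tendsto (fun k => ‖x (k - 1) - xs‖ ^ 2) atTop (𝓝 0) := by
    have h16 := hrate.const_mul (16 / α ^ 2)
    rw [mul_zero] at h16
    refine squeeze_zero' (Eventually.of_forall fun k => by positivity) ?_ h16
    filter_upwards [hlow, eventually_ge_atTop 1] with k hk hk1
    have hk1' : (1 : ℝ) ≤ k := by exact_mod_cast hk1
    have hk0 : (0 : ℝ) < k := by linarith
    have hpow : ((k : ℝ) ^ q) ^ 2 ≤ (k : ℝ) ^ (2 : ℝ) := by
      rw [Real.rpow_two]
      gcongr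
      simpa using Real.rpow_le_rpow_of_exponent_le hk1' hq1.le
    have hE0 : 0 ≤ iterEnergy f α q c p lam δ m (‖xs‖ ^ 2) xs x k := le_trans (by positivity) hk
    calc ‖x (k - 1) - xs‖ ^ 2
        = 16 / α ^ 2 * (((k : ℝ) ^ q) ^ 2 *
            ((α / (k : ℝ) ^ q) ^ 2 / 16 * ‖x (k - 1) - xs‖ ^ 2)) := by
          field_simp
      _ ≤ 16 / α ^ 2 * ((k : ℝ) ^ (2 : ℝ) *
            iterEnergy f α q c p lam δ m (‖xs‖ ^ 2) xs x k) := by gcongr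
  have hsq' := (tendsto_add_atTop_iff_nat 1).2 hsq
  simp only [Nat.add_sub_cancel] at hsq'
  rw [tendsto_iff_norm_sub_tendsto_zero]
  simpa [Real.sqrt_sq] using hsq'.sqrt

end Iteration

theorem liminf_coe_eq_zero_of_frequently_lt {d : ℕ → ℝ} (hd : ∀ k, 0 ≤ d k)
    (h : ∀ η : ℝ, 0 < η → ∃ᶠ k in atTop, d k < η) :
    liminf (fun k => (d k : EReal)) atTop = 0 := by
  refine le_antisymm ?_ ?_
  · refine EReal.le_of_forall_lt_iff_le.1 fun η hη => ?_
    refine liminf_le_of_frequently_le' ((h η (by exact_mod_cast hη)).mono fun k hk => ?_)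
    exact_mod_cast hk.le
  · exact le_liminf_of_le (by isBoundedDefault)
      (Eventually.of_forall fun k => by exact_mod_cast hd k)

theorem theorem3p2 {H : Type*} [NormedAddCommGroup H] [InnerProductSpace ℝ H] [CompleteSpace H]
    (f : H → EReal) (hproper : IsProperFun f) (hconv : IsConvexFun f)
    (hlsc : LowerSemicontinuous f) (hne : (argminSet f).Nonempty)
    (α q c p lam δ : ℝ) (hα : 0 < α) (hc : 0 < c)
    (hq0 : 0 < q) (hq1 : q < 1) (hp1 : 1 < p) (hpq : p < q + 1)
    (hlam : 0 < lam) (hδ : (p - q - 1 < δ ∧ δ < 0) ∨ (δ = 0 ∧ lam < 1))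
    (x : ℕ → H) (hx : IsPIATRSequence f α q c p lam δ x) :
    (∃! xs : H, IsMinNormMinimizer f xs) ∧
    ∀ xs : H, IsMinNormMinimizer f xs →
      -- the lower limit is taken in the extended reals, so that it has no junk value
      liminf (fun k : ℕ => ((‖x k - xs‖ : ℝ) : EReal)) atTop = 0 ∧
      (((∀ᶠ k in atTop, x k ∈ Metric.ball (0 : H) ‖xs‖) ∨
          (∀ᶠ k in atTop, x k ∉ Metric.ball (0 : H) ‖xs‖)) →
        Tendsto x atTop (𝓝 xs)) := by
  obtain ⟨m, hm, hmin⟩ := exists_min_value hproper hne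
  have hCconv : Convex ℝ (argminSet f) := hm ▸ hconv.convex_sublevel m
  have hCclosed : IsClosed (argminSet f) := hm ▸ hlsc.isClosed_preimage (m : EReal)
  refine ⟨?_, fun xs hxs => ?_⟩
  · obtain ⟨xs, h1, h2⟩ := exists_min_norm_of_isClosed_convex hne hCclosed hCconv
    exact ⟨xs, ⟨h1, h2⟩, fun y hy => eq_of_isMinNormMinimizer hCconv hy ⟨h1, h2⟩⟩
  have hfxs : f xs = m := by
    have h1 := hxs.1
    rw [hm] at h1
    exact le_antisymm h1 (hmin xs)
  have hbot := hproper.1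
  have hxs_top : f xs ≠ ⊤ := by
    rw [hfxs]
    exact EReal.coe_ne_top m
  have hδ0 : δ ≤ 0 := by
    rcases hδ with h | h
    · exact h.2.le
    · exact h.1.le
  have hpδ : p - q - 1 < δ := by
    rcases hδ with h | h
    · exact h.1
    · rw [h.1]
      linarith
  have hgap := tendsto_gap hbot hconv hmin hfxs hα hc hq0 hq1 hp1 hpq hlam hδ0 hpδ hx
  have hnear : ∀ η : ℝ, 0 < η →
      ∀ᶠ k in atTop, x k ∈ Metric.ball (0 : H) ‖xs‖ → ‖x k - xs‖ < η := by
    intro η hη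
    obtain ⟨ε, hε, h⟩ := exists_sublevel_norm_sub_lt hconv hlsc hm hxs hη
    filter_upwards [hgap.eventually (gt_mem_nhds hε), eventually_ge_atTop 2] with k hk hk2 hball
    refine h _ ?_ (mem_ball_zero_iff.1 hball).le
    rw [← EReal.coe_toReal (hx.ne_top hxs_top hk2) (hbot _), EReal.coe_le_coe_iff]
    linarith
  have hout : (∀ᶠ k in atTop, x k ∉ Metric.ball (0 : H) ‖xs‖) → Tendsto x atTop (𝓝 xs) :=
    fun h => tendsto_of_eventually_norm_le hbot hconv hmin hfxs hα hc hq0 hq1 hp1 hpq hlam hδ0 hx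
      (h.mono fun k hk => by simpa using hk)
  refine ⟨liminf_coe_eq_zero_of_frequently_lt (fun k => norm_nonneg _) fun η hη => ?_, ?_⟩
  · by_cases h : ∀ᶠ k in atTop, x k ∉ Metric.ball (0 : H) ‖xs‖
    · exact ((tendsto_iff_norm_sub_tendsto_zero.1 (hout h)).eventually (gt_mem_nhds hη)).frequently
    · have h' : ∃ᶠ k in atTop, x k ∈ Metric.ball (0 : H) ‖xs‖ := by
        simpa [Filter.Frequently] using h
      exact (h'.and_eventually (hnear η hη)).mono fun k hk => hk.2 hk.1
  · rintro (h | h)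
    · rw [Metric.tendsto_atTop']
      intro η hη
      obtain ⟨n, hn⟩ := eventually_atTop.1 (h.and (hnear η hη))
      refine ⟨n, fun k hk => ?_⟩
      rw [dist_eq_norm]
      exact (hn k hk.le).2 (hn k hk.le).1
    · exact hout h
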